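/- All spaces are complex. For $0<p\le\infty$ let $S_p(H)$ be the Schatten class of compact operators $U$ in a Hilbert space $H$ whose sequence of singular numbers lies in $l_p$, with quasinorm $\sigma_p(U)=\|(\mu_n(U))\|_{l_p}$, and for an operator $T:X\to Y$ of Banach spaces put $\gamma_{S_p}(T)=\inf\|A\|\,\sigma_p(U)\,\|B\|$, the infimum being over all factorizations $T=BUA$ with $A\in L(X,H)$, $U\in S_p(H)$, $B\in L(H,Y)$, $H$ a Hilbert space. For $0<p\le1$ let $\nu_p(T)=\inf\bigl(\sum_k\|x'_k\|^p\|y_k\|^p\bigr)^{1/p}$ over all representations $Tx=\sum_k\langle x'_k,x\rangle y_k$. For $0<p\le 2$ let $\nu_{p;2}(T)=\inf\|(a_k)\|_{l_p}$ over all representations $Tx=\sum_k a_k\langle x'_k,x\rangle y_k$ with $\|x'_k\|\le1$ and $\sup_{\|y'\|\le1}\bigl(\sum_k|\langle y',y_k\rangle|^2\bigr)^{1/2}\le1$. For an operator $T$ in a finite-dimensional space let $\|\lambda(T)\|_p=\bigl(\sum_{\lambda}|\lambda|^p\bigr)^{1/p}$, the sum being over all eigenvalues of $T$ counted with algebraic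 multiplicity. **Theorem.** For $n\ge1$ let $A_n:l_1^n\to l_1^n$ be the operator given by the matrix $\bigl(n^{-1/2}e^{2\pi i jl/n}\bigr)_{j,l=1}^n$. There is an absolute constant $G>0$ such that for all $n\ge1$ and $m\ge1$ the operator $A_n^m$ has rank $n$ and the following holds. 1. If $s_1,\dots,s_m\in(0,1]$, $1/s=1/s_1+\dots+1/s_m-(m+1)/2$ and $0<t\le s$, then $$\gamma_{S_t}(A_n^m)\ \ge\ G\,n^{1/t-1/s}\prod_{k=1}^m\nu_{s_k}(A_n).$$ 2. If $s_1,\dots,s_m\in(0,2]$ and $1/\tilde s=1/s_1+\dots+1/s_m$, then $$\prod_{k=1}^m\nu_{s_k;2}(A_n)=\|\lambda(A_n^m)\|_{\tilde s}.$$ 3. (The estimate $\gamma_{S_t}(T_m\cdots T_1)\le(\operatorname{rank}T_m\cdots T_1)^{1/t-1/s}\prod_k\nu_{s_k;2}(T_k)$ is sharp up to an absolute constant.) If $s_1,\dots,s_m\in(0,2]$, $1/s=1/s_1+\dots+1/s_m-1/2$ and $0<t\le s$, then $$\gamma_{S_t}(A_n^m)\ \ge\ G\,n^{1/t-1/s}\prod_{k=1}^m\nu_{s_k;2}(A_n).$$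 4. (The estimate $\|\lambda(T_m\cdots T_1)\|_t\le(\operatorname{rank}T_m\cdots T_1)^{1/t-1/\tilde s}\prod_k\nu_{s_k;2}(T_k)$ is sharp.) If $s_1,\dots,s_m\in(0,2]$, $1/\tilde s=1/s_1+\dots+1/s_m$ and $0<t\le\tilde s$, then $$\|\lambda(A_n^m)\|_t=n^{1/t-1/\tilde s}\prod_{k=1}^m\nu_{s_k;2}(A_n).$$ In 1 and 3 the values $s=\infty$ and $t=\infty$ are allowed, with $1/\infty=0$. -/

import Mathlib

open scoped ENNReal NNReal

noncomputable section

/-- The `l_p` quasinorm, `0 < p ≤ ∞`, of a sequence of absolute values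
(equal to `∞` when the sequence is not in `l_p`). -/
def lpQuasinorm (p : ℝ≥0∞) (a : ℕ → ℝ≥0∞) : ℝ≥0∞ :=
  if p = ∞ then ⨆ n, a n else (∑' n, a n ^ p.toReal) ^ (1 / p.toReal)

section Banach

variable {X Y : Type*} [NormedAddCommGroup X] [NormedSpace ℂ X]
  [NormedAddCommGroup Y] [NormedSpace ℂ Y]

/-- The quasinorm `ν_p` of `p`-nuclear operators, `0 < p ≤ 1`: the infimum of
`(∑ ‖x'ₖ‖ ^ p ‖yₖ‖ ^ p) ^ (1 / p)` over all representations `T x = ∑ ⟨x'ₖ, x⟩ yₖ`.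
It is `∞` exactly when `T` is not `p`-nuclear. -/
def nuclearQuasinorm (p : ℝ≥0∞) (T : X →L[ℂ] Y) : ℝ≥0∞ :=
  ⨅ (x' : ℕ → StrongDual ℂ X) (y : ℕ → Y)
    (_ : ∀ x, HasSum (fun k => x' k x • y k) (T x)),
    lpQuasinorm p fun k => ‖x' k‖ₑ * ‖y k‖ₑ

/-- The weak `l_2` norm `sup_{‖y'‖ ≤ 1} (∑ |⟨y', yₖ⟩| ^ 2) ^ (1 / 2)` of a sequence. -/
def weakTwoNorm (y : ℕ → Y) : ℝ≥0∞ :=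
  ⨆ (y' : StrongDual ℂ Y) (_ : ‖y'‖ ≤ 1), lpQuasinorm 2 fun k => ‖y' (y k)‖ₑ

/-- The quasinorm `ν_{p;2}` of `(p;2)`-nuclear operators, `0 < p ≤ 2`: the infimum of
`‖(aₖ)‖_{l_p}` over all representations `T x = ∑ aₖ ⟨x'ₖ, x⟩ yₖ` with `‖x'ₖ‖ ≤ 1` and
with the weak `l_2` norm of `(yₖ)` at most `1`. -/
def nuclearTwoQuasinorm (p : ℝ≥0∞) (T : X →L[ℂ] Y) : ℝ≥0∞ :=
  ⨅ (a : ℕ → ℂ) (x' : ℕ → StrongDual ℂ X) (y : ℕ → Y)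
    (_ : ∀ k, ‖x' k‖ ≤ 1) (_ : weakTwoNorm y ≤ 1)
    (_ : ∀ x, HasSum (fun k => (a k * x' k x) • y k) (T x)),
    lpQuasinorm p fun k => ‖a k‖ₑ

end Banach

section Hilbert

variable {H : Type*} [NormedAddCommGroup H] [InnerProductSpace ℂ H]

/-- The singular numbers `μ_0 ≥ μ_1 ≥ …` of an operator in a Hilbert space, as its
approximation numbers: `μ_n` is the distance to the operators of rank at most `n`. For compact
`U` these are the eigenvalues of `(U* U) ^ (1 / 2)` in decreasing order, with multiplicities,
followed by zeros if there are only finitely many nonzero ones. -/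
def singularNumber (U : H →L[ℂ] H) (n : ℕ) : ℝ≥0∞ :=
  ⨅ (F : H →L[ℂ] H) (_ : LinearMap.rank (F : H →ₗ[ℂ] H) ≤ n), ‖U - F‖ₑ

/-- The Schatten quasinorm `σ_p`, `0 < p ≤ ∞`. -/
def schattenQuasinorm (p : ℝ≥0∞) (U : H →L[ℂ] H) : ℝ≥0∞ :=
  lpQuasinorm p (singularNumber U)

/-- Membership in the Schatten class `S_p(H)`, `0 < p ≤ ∞`. -/
def MemSchatten (p : ℝ≥0∞) (U : H →L[ℂ] H) : Prop :=
  IsCompactOperator U ∧ schattenQuasinorm p U < ∞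

end Hilbert

section Banach

variable {X Y : Type*} [NormedAddCommGroup X] [NormedSpace ℂ X]
  [NormedAddCommGroup Y] [NormedSpace ℂ Y]

/-- The factorization quasinorm `γ_{S_p}(T) = inf ‖A‖ σ_p(U) ‖B‖` over all factorizations
`T = B U A` through an operator `U ∈ S_p(H)` in a complex Hilbert space `H`. (`U` is compact, so
it is enough to let `H` range over the Hilbert spaces in the lowest universe: these include a
copy of every separable one.) -/
def schattenFactorization (p : ℝ≥0∞) (T : X →L[ℂ] Y) : ℝ≥0∞ :=
  ⨅ (H : Type) (_ : NormedAddCommGroup H) (_ : InnerProductSpace ℂ H) (_ : CompleteSpace H)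
    (A : X →L[ℂ] H) (U : H →L[ℂ] H) (B : H →L[ℂ] Y)
    (_ : MemSchatten p U) (_ : T = B ∘L U ∘L A),
    ‖A‖ₑ * schattenQuasinorm p U * ‖B‖ₑ

/-- The `l_p` quasinorm, `0 < p < ∞`, of the complete system of eigenvalues of an operator in a
finite-dimensional space, counted with algebraic multiplicity. -/
def eigenvalueQuasinorm [FiniteDimensional ℂ X] (p : ℝ≥0∞) (T : X →L[ℂ] X) : ℝ≥0∞ :=
  (((T : X →ₗ[ℂ] X).charpoly.roots.map fun z => ‖z‖ₑ ^ p.toReal).sum) ^ (1 / p.toReal)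

end Banach

/-- The complex space `l_1^n`. -/
abbrev EllOne (n : ℕ) : Type := PiLp 1 fun _ : Fin n => ℂ

/-- The normalized Fourier matrix `n ^ (-1 / 2) exp(2 π i j l / n)`, `j, l = 1, …, n`. -/
def fourierMatrix (n : ℕ) : Matrix (Fin n) (Fin n) ℂ :=
  Matrix.of fun j l =>
    ((Real.sqrt n : ℝ) : ℂ)⁻¹ *
      Complex.exp (2 * Real.pi * Complex.I * ((j : ℕ) + 1) * ((l : ℕ) + 1) / n)

/-- The operator in `l_1^n` given by the normalized Fourier matrix. -/
def fourierOperator (n : ℕ) : EllOne n →L[ℂ] EllOne n :=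
  LinearMap.toContinuousLinearMap (Matrix.toLpLin 1 1 (fourierMatrix n))

end

/-! ### The arithmetic-geometric mean inequality -/

/-! The Fourier matrix is unitary with all entries of modulus n^(-1/2), and every lower bound comes
from the single fact |det A_n^m| = 1, with G = 1.

Let T = BUA be an operator in l_1^n factored through a Hilbert space. Seen from l_2^n, the factor A
sends the n unit vectors to vectors of norm at most ‖A‖, while B has Hilbert-Schmidt norm at most
‖B‖ as a map into l_2^n (`sum_norm_sq_le_opNorm_sq`). The arithmetic-geometric mean inequality turns
these facts into volume bounds, and `enorm_det_le_of_factorization` gives |det T| ≤ (n^(-1/2) ‖A‖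
‖B‖)^n ∏ μ_k(U), with the first n singular numbers. By the same inequality the product is at most
(n^(-1/t) σ_t(U))^n. Hence |det T| = 1 forces γ_{S_t}(T) ≥ n^(1/t + 1/2).

A finite (s;2)-nuclear representation is itself such a factorization with diagonal U
(`enorm_det_le_of_antitone`). Passing to the limit along partial sums gives ν_{s;2}(T) ≥ n^(1/s)
whenever |det T| = 1. Expanding A_n along its rows yields ν_{s;2}(A_n) ≤ n^(1/s) and ν_s(A_n) ≤
n^(1/s - 1/2). The eigenvalues of A_n^m are unimodular, so their l_p quasinorm is n^(1/p). All four
claims then reduce to adding exponents of n. -/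

theorem Real.prod_le_sum_div_card_pow {ι : Type*} (s : Finset ι) (z : ι → ℝ)
    (hz : ∀ i ∈ s, 0 ≤ z i) : ∏ i ∈ s, z i ≤ ((∑ i ∈ s, z i) / s.card) ^ s.card := by
  rcases s.eq_empty_or_nonempty with rfl | hs
  · simp
  have hc : (0 : ℝ) < s.card := by exact_mod_cast hs.card_pos
  have h := Real.geom_mean_le_arith_mean s (fun _ => 1) z (fun _ _ => zero_le_one)
    (by simpa using hs) hz
  simp only [Real.rpow_one, Finset.sum_const, nsmul_eq_mul, mul_one, one_mul] at h
  have hp : 0 ≤ ∏ i ∈ s, z i := Finset.prod_nonneg hz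
  calc ∏ i ∈ s, z i = ((∏ i ∈ s, z i) ^ ((s.card : ℝ)⁻¹)) ^ s.card :=
        (Real.rpow_inv_natCast_pow hp hs.card_pos.ne').symm
    _ ≤ _ := by gcongr

theorem ENNReal.prod_le_sum_div_card_pow {ι : Type*} (s : Finset ι) (z : ι → ℝ≥0∞) :
    ∏ i ∈ s, z i ≤ ((∑ i ∈ s, z i) / s.card) ^ s.card := by
  rcases s.eq_empty_or_nonempty with rfl | hs
  · simp
  by_cases h : ∃ i ∈ s, z i = ∞
  · rw [ENNReal.sum_eq_top.2 h, ENNReal.top_div_of_ne_top (by simp),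
      ENNReal.top_pow hs.card_pos.ne']
    exact le_top
  · push Not at h
    have h2 : ∀ i ∈ s, z i = ENNReal.ofReal (z i).toReal :=
      fun i hi => (ENNReal.ofReal_toReal (h i hi)).symm
    have hc : (0 : ℝ) < s.card := by exact_mod_cast hs.card_pos
    rw [Finset.prod_congr rfl h2, Finset.sum_congr rfl h2,
      ← ENNReal.ofReal_prod_of_nonneg (by simp), ← ENNReal.ofReal_sum_of_nonneg (by simp),
      ← ENNReal.ofReal_natCast, ← ENNReal.ofReal_div_of_pos hc,
      ← ENNReal.ofReal_pow (by positivity)]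
    exact ENNReal.ofReal_le_ofReal (Real.prod_le_sum_div_card_pow s _ (by simp))

/-- The first `n` terms of a sequence in `l_t` have product at most `(n ^ (-1 / t) ‖c‖_t) ^ n`. -/
theorem prod_range_le_lpQuasinorm {n : ℕ} (hn : 1 ≤ n) {t : ℝ≥0∞} (ht : 0 < t) (c : ℕ → ℝ≥0∞) :
    ∏ k ∈ Finset.range n, c k ≤ (lpQuasinorm t c / (n : ℝ≥0∞) ^ (t⁻¹).toReal) ^ n := by
  have hn0 : (n : ℝ≥0∞) ≠ 0 := by exact_mod_cast (by omega : n ≠ 0)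
  unfold lpQuasinorm
  split_ifs with h
  · subst h
    simp only [ENNReal.inv_top, ENNReal.toReal_zero, ENNReal.rpow_zero, div_one]
    calc _ ≤ ∏ k ∈ Finset.range n, ⨆ i, c i := Finset.prod_le_prod' fun i _ => le_iSup c i
      _ = _ := by simp
  · have htr : 0 < t.toReal := ENNReal.toReal_pos ht.ne' h
    have h1 := ENNReal.prod_le_sum_div_card_pow (Finset.range n) fun k => c k ^ t.toReal
    rw [ENNReal.prod_rpow_of_nonneg htr.le, Finset.card_range] at h1
    have h2 := ENNReal.rpow_le_rpow h1 (one_div_nonneg.2 htr.le)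
    rw [← ENNReal.rpow_mul, mul_one_div_cancel htr.ne', ENNReal.rpow_one] at h2
    refine h2.trans ?_
    rw [← ENNReal.rpow_natCast, ← ENNReal.rpow_mul, mul_comm, ENNReal.rpow_mul,
      ENNReal.rpow_natCast, ENNReal.div_rpow_of_nonneg _ _ (by positivity), ENNReal.toReal_inv,
      one_div]
    gcongr
    exact ENNReal.sum_le_tsum _

/-! ### Determinants and singular numbers -/

open scoped ComplexOrder in
-- The square of the volume factor is the Gram determinant, a product of nonnegative eigenvalues
-- whose sum is the trace, that is, the squared Hilbert-Schmidt norm. The arithmetic-geometric mean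
-- inequality compares the two.
theorem LinearMap.normDet_sq_le {U V ι : Type*} [NormedAddCommGroup U] [InnerProductSpace ℂ U]
    [FiniteDimensional ℂ U] [NormedAddCommGroup V] [InnerProductSpace ℂ V] [Fintype ι]
    (f : U →ₗ[ℂ] V) (b : OrthonormalBasis ι ℂ U) :
    f.normDet ^ 2 ≤ ((∑ i, ‖f (b i)‖ ^ 2) / Fintype.card ι) ^ Fintype.card ι := by
  classical
  have hG : (Matrix.gram ℂ (f <| b ·)).PosSemidef := Matrix.posSemidef_gram ℂ _
  have h1 := f.normDet_sq_eq_det_gram b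
  rw [hG.isHermitian.det_eq_prod_eigenvalues] at h1
  have h2 := hG.isHermitian.trace_eq_sum_eigenvalues
  have h3 : f.normDet ^ 2 = ∏ i, hG.isHermitian.eigenvalues i := by exact_mod_cast h1
  have h4 : ∑ i, ‖f (b i)‖ ^ 2 = ∑ i, hG.isHermitian.eigenvalues i := by
    have : ((∑ i, ‖f (b i)‖ ^ 2 : ℝ) : ℂ) = ((∑ i, hG.isHermitian.eigenvalues i : ℝ) : ℂ) := by
      push_cast
      simp only [Matrix.trace, Matrix.diag_apply, Matrix.gram_apply, inner_self_eq_norm_sq_to_K]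
        at h2
      exact_mod_cast h2
    exact_mod_cast this
  rw [h3, h4]
  exact Real.prod_le_sum_div_card_pow Finset.univ _ fun i _ => hG.eigenvalues_nonneg i

/-- A vector in the span of the first `k + 1` singular vectors that is killed by a map of rank
at most `k` witnesses the lower bound of the `k`-th approximation number. -/
theorem LinearMap.singularValues_le_of_rank_le {E V W : Type*} [NormedAddCommGroup E]
    [InnerProductSpace ℂ E] [FiniteDimensional ℂ E] [NormedAddCommGroup V] [InnerProductSpace ℂ V]
    [FiniteDimensional ℂ V] [AddCommGroup W] [Module ℂ W] (f : E →ₗ[ℂ] V) (g : E →ₗ[ℂ] W) (k : ℕ)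
    (hk : k < Module.finrank ℂ E) (hg : LinearMap.rank g ≤ k) :
    ∃ x : E, x ≠ 0 ∧ g x = 0 ∧ f.singularValues k * ‖x‖ ≤ ‖f x‖ := by
  set d := Module.finrank ℂ E with hd
  have hS := f.isSymmetric_adjoint_comp_self
  set b := hS.eigenvectorBasis hd.symm with hb
  let e : Fin (k + 1) → Fin d := Fin.castLE hk
  have he : Function.Injective e := Fin.castLE_injective hk
  let v : Fin (k + 1) → E := fun i => b (e i)
  have hv : Orthonormal ℂ v := b.orthonormal.comp e he
  let L : (Fin (k + 1) → ℂ) →ₗ[ℂ] E := Fintype.linearCombination ℂ v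
  -- Dimension count: the coefficient space has dimension k + 1, one more than the rank allows.
  have hker : ∃ c : Fin (k + 1) → ℂ, c ≠ 0 ∧ (g ∘ₗ L) c = 0 := by
    by_contra! hcon
    have hinj : Function.Injective (g ∘ₗ L) := by
      rw [← LinearMap.ker_eq_bot, LinearMap.ker_eq_bot']
      intro c hc
      by_contra h0
      exact hcon c h0 hc
    have h1 := LinearMap.finrank_range_of_inj hinj
    have h2 := Module.finrank_le_of_rank_le ((LinearMap.rank_comp_le_left L g).trans hg)
    rw [h1, Module.finrank_fin_fun] at h2
    omega
  obtain ⟨c, hc0, hc⟩ := hker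
  have hLc : L c = ∑ i, c i • v i := by simp [L, Fintype.linearCombination_apply]
  have hnorm : ‖L c‖ ^ 2 = ∑ i, ‖c i‖ ^ 2 := by
    have h1 : (inner ℂ (L c) (L c) : ℂ) = ∑ i, (starRingEnd ℂ) (c i) * c i := by
      rw [hLc, hv.inner_sum]
    rw [inner_self_eq_norm_sq_to_K] at h1
    simp only [RCLike.conj_mul] at h1
    exact_mod_cast h1
  refine ⟨L c, ?_, hc, ?_⟩
  · intro h0
    rw [h0] at hnorm
    have h1 : ∑ i, ‖c i‖ ^ 2 = 0 := by simpa using hnorm.symm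
    apply hc0
    ext i
    have := (Finset.sum_eq_zero_iff_of_nonneg (fun i _ => by positivity)).1 h1 i (Finset.mem_univ i)
    simpa using this
  · apply le_of_sq_le_sq _ (norm_nonneg _)
    have h1 : (inner ℂ (L c) (LinearMap.adjoint f (f (L c))) : ℂ)
        = ∑ i, (starRingEnd ℂ) (c i) * (c i * (hS.eigenvalues hd.symm (e i) : ℂ)) := by
      have h2 : LinearMap.adjoint f (f (L c))
          = ∑ i, (c i * (hS.eigenvalues hd.symm (e i) : ℂ)) • v i := by
        rw [hLc, ← LinearMap.comp_apply, map_sum]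
        refine Finset.sum_congr rfl fun i _ => ?_
        rw [map_smul, hS.apply_eigenvectorBasis, smul_smul]
        rfl
      rw [h2, hLc, hv.inner_sum]
    rw [LinearMap.adjoint_inner_right, inner_self_eq_norm_sq_to_K] at h1
    have h3 : ‖f (L c)‖ ^ 2 = ∑ i, ‖c i‖ ^ 2 * hS.eigenvalues hd.symm (e i) := by
      have : ((‖f (L c)‖ ^ 2 : ℝ) : ℂ)
          = ((∑ i, ‖c i‖ ^ 2 * hS.eigenvalues hd.symm (e i) : ℝ) : ℂ) := by
        push_cast
        simp only [← mul_assoc, RCLike.conj_mul] at h1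
        simpa using h1
      exact_mod_cast this
    rw [mul_pow, hnorm, h3, f.sq_singularValues_of_lt hd.symm hk, Finset.mul_sum]
    refine Finset.sum_le_sum fun i _ => ?_
    rw [mul_comm]
    gcongr
    apply hS.eigenvalues_antitone
    exact Fin.mk_le_mk.2 (Nat.lt_succ_iff.1 i.2)

/-- The volume factor is the product of the singular values of the restriction to `E`. Each is
dominated by the corresponding approximation number of `U` on the whole space: any competitor `F` of
rank at most k kills a vector of `E` that `U` stretches by at least the k-th singular value. -/
theorem normDet_domRestrict_le {H : Type*} [NormedAddCommGroup H] [InnerProductSpace ℂ H]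
    (U : H →L[ℂ] H) (E : Submodule ℂ H) [FiniteDimensional ℂ E] :
    ENNReal.ofReal ((U : H →ₗ[ℂ] H).domRestrict E).normDet
      ≤ ∏ k ∈ Finset.range (Module.finrank ℂ E), singularNumber U k := by
  -- `H` may be infinite-dimensional; restricting the codomain to the range makes singular values
  -- available and keeps the volume factor.
  set f := ((U : H →ₗ[ℂ] H).domRestrict E).rangeRestrict with hf
  have h1 : ((U : H →ₗ[ℂ] H).domRestrict E).normDet = f.normDet :=
    (LinearMap.normDet_codRestrict _).symm
  rw [h1, f.normDet_eq_prod_singularValues,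
    ENNReal.ofReal_prod_of_nonneg fun i _ => f.singularValues_nonneg i]
  refine Finset.prod_le_prod' fun k hk => ?_
  refine le_iInf₂ fun F hF => ?_
  obtain ⟨x, hx0, hgx, hx⟩ := f.singularValues_le_of_rank_le
    ((F : H →ₗ[ℂ] H) ∘ₗ E.subtype) k (Finset.mem_range.1 hk)
    ((LinearMap.rank_comp_le_left _ _).trans hF)
  rw [← ofReal_norm]
  apply ENNReal.ofReal_le_ofReal
  have hxpos : 0 < ‖x‖ := norm_pos_iff.2 hx0
  refine le_of_mul_le_mul_right (hx.trans ?_) hxpos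
  have h2 : ‖f x‖ = ‖(U - F) (x : H)‖ := by
    have h3 : F (x : H) = 0 := hgx
    rw [_root_.sub_apply, h3, sub_zero]
    rfl
  rw [h2]
  exact (U - F).le_opNorm _

/-! ### The Fourier matrix -/

theorem fourierMatrix_apply (n : ℕ) (j l : Fin n) :
    fourierMatrix n j l = ((Real.sqrt n : ℝ) : ℂ)⁻¹ *
      Complex.exp (2 * Real.pi * Complex.I / n) ^ (((j : ℕ) + 1) * ((l : ℕ) + 1)) := by
  rw [fourierMatrix, Matrix.of_apply, ← Complex.exp_nat_mul]
  congr 2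
  push_cast
  ring

theorem norm_fourierMatrix_apply {n : ℕ} (j l : Fin n) :
    ‖fourierMatrix n j l‖ = (Real.sqrt n)⁻¹ := by
  have h : ‖Complex.exp (2 * Real.pi * Complex.I / n)‖ = 1 := by
    have : (2 * Real.pi * Complex.I / n : ℂ) = ((2 * Real.pi / n : ℝ) : ℂ) * Complex.I := by
      push_cast
      ring
    rw [this, Complex.norm_exp_ofReal_mul_I]
  rw [fourierMatrix_apply, norm_mul, norm_pow, h, one_pow, mul_one, norm_inv, Complex.norm_real,
    Real.norm_of_nonneg (Real.sqrt_nonneg _)]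

theorem fourierMatrix_mem_unitaryGroup {n : ℕ} (hn : 1 ≤ n) :
    fourierMatrix n ∈ Matrix.unitaryGroup (Fin n) ℂ := by
  rw [Matrix.mem_unitaryGroup_iff]
  ext j l
  set ζ : ℂ := Complex.exp (2 * Real.pi * Complex.I / n) with hζ
  have hprim : IsPrimitiveRoot ζ n := Complex.isPrimitiveRoot_exp n (by omega)
  have hζ0 : ζ ≠ 0 := Complex.exp_ne_zero _
  have hnorm : ‖ζ‖ = 1 := hprim.norm'_eq_one (by omega)
  have hconj : (starRingEnd ℂ) ζ = ζ⁻¹ := (Complex.inv_eq_conj hnorm).symm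
  have hs : ((Real.sqrt n : ℝ) : ℂ)⁻¹ * ((Real.sqrt n : ℝ) : ℂ)⁻¹ = (n : ℂ)⁻¹ := by
    rw [← mul_inv, ← Complex.ofReal_mul, Real.mul_self_sqrt (by positivity), Complex.ofReal_natCast]
  have hn0 : (n : ℂ) ≠ 0 := by exact_mod_cast (by omega : n ≠ 0)
  have hterm : ∀ k : Fin n, fourierMatrix n j k * (starRingEnd ℂ) (fourierMatrix n l k)
      = (n : ℂ)⁻¹ * ((ζ ^ ((j : ℕ) + 1) * (ζ ^ ((l : ℕ) + 1))⁻¹) *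
        (ζ ^ ((j : ℕ) + 1) * (ζ ^ ((l : ℕ) + 1))⁻¹) ^ (k : ℕ)) := by
    intro k
    rw [fourierMatrix_apply, fourierMatrix_apply, ← hζ, map_mul, map_pow, hconj, map_inv₀,
      Complex.conj_ofReal, ← hs, ← pow_succ', mul_pow, inv_pow, inv_pow, pow_mul, pow_mul]
    ring
  simp only [Matrix.mul_apply, Matrix.star_apply, RCLike.star_def, hterm]
  rw [← Finset.mul_sum, ← Finset.mul_sum]
  -- w = ζ^(j-l) is an n-th root of unity, equal to 1 only for j = l, so off the diagonal the
  -- geometric sum vanishes.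
  set w := ζ ^ ((j : ℕ) + 1) * (ζ ^ ((l : ℕ) + 1))⁻¹ with hw
  rw [Fin.sum_univ_eq_sum_range (fun k => w ^ k) n]
  have hwn : w ^ n = 1 := by
    rw [hw, mul_pow, inv_pow, ← pow_mul, ← pow_mul, mul_comm _ n, mul_comm _ n, pow_mul, pow_mul,
      hprim.pow_eq_one, one_pow, one_pow, inv_one, mul_one]
  by_cases hjl : j = l
  · have hw1 : w = 1 := by
      rw [hw, hjl, mul_inv_cancel₀ (pow_ne_zero _ hζ0)]
    rw [hw1, hjl, Matrix.one_apply_eq]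
    simp [hn0]
  · have hw1 : w ≠ 1 := by
      intro h
      rw [hw, mul_inv_eq_one₀ (pow_ne_zero _ hζ0), pow_succ, pow_succ] at h
      exact hjl (Fin.ext (hprim.pow_inj j.2 l.2 (mul_right_cancel₀ hζ0 h)))
    rw [geom_sum_eq hw1, hwn, sub_self, zero_div, mul_zero, mul_zero, Matrix.one_apply_ne hjl]

theorem fourierOperator_pow (n m : ℕ) :
    ((fourierOperator n ^ m : EllOne n →L[ℂ] EllOne n) : EllOne n →ₗ[ℂ] EllOne n)
      = Matrix.toLpLin 1 1 (fourierMatrix n ^ m) := by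
  rw [Matrix.toLpLin_pow]
  induction m with
  | zero => rfl
  | succ m ih =>
    rw [pow_succ, pow_succ, ← ih]
    rfl

theorem norm_det_fourierOperator_pow {n : ℕ} (hn : 1 ≤ n) (m : ℕ) :
    ‖LinearMap.det ((fourierOperator n ^ m : EllOne n →L[ℂ] EllOne n) :
      EllOne n →ₗ[ℂ] EllOne n)‖ = 1 := by
  rw [fourierOperator_pow, LinearMap.det_toLpLin]
  exact CStarRing.norm_of_mem_unitary
    (Matrix.det_of_mem_unitary (pow_mem (fourierMatrix_mem_unitaryGroup hn) m))

theorem finrank_range_fourierOperator_pow {n : ℕ} (hn : 1 ≤ n) (m : ℕ) :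
    Module.finrank ℂ (LinearMap.range ((fourierOperator n ^ m : EllOne n →L[ℂ] EllOne n) :
        EllOne n →ₗ[ℂ] EllOne n)) = n := by
  have h : LinearMap.det ((fourierOperator n ^ m : EllOne n →L[ℂ] EllOne n) :
      EllOne n →ₗ[ℂ] EllOne n) ≠ 0 := by
    rw [← norm_ne_zero_iff, norm_det_fourierOperator_pow hn]
    exact one_ne_zero
  have htop := (LinearMap.equivOfDetNeZero _ h).range
  change LinearMap.range ((fourierOperator n ^ m : EllOne n →L[ℂ] EllOne n) :
    EllOne n →ₗ[ℂ] EllOne n) = ⊤ at htop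
  rw [htop, finrank_top, (WithLp.linearEquiv 1 ℂ (Fin n → ℂ)).finrank_eq, Module.finrank_fin_fun]

/-- Parseval's identity for the Fourier matrix. -/
theorem sum_norm_sq_fourierMatrix_transform {n : ℕ} (hn : 1 ≤ n) (y : Fin n → ℂ) :
    ∑ l, ‖∑ i, fourierMatrix n l i * y i‖ ^ 2 = ∑ i, ‖y i‖ ^ 2 := by
  have h := (Matrix.mem_unitaryGroup_iff'.1 (fourierMatrix_mem_unitaryGroup hn))
  have h1 : star ((fourierMatrix n).mulVec y) ⬝ᵥ (fourierMatrix n).mulVec y = star y ⬝ᵥ y := by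
    rw [Matrix.star_mulVec, Matrix.dotProduct_mulVec, Matrix.vecMul_vecMul,
      ← Matrix.star_eq_conjTranspose, h, Matrix.vecMul_one]
  simp only [dotProduct, Pi.star_apply, RCLike.star_def, RCLike.conj_mul, Matrix.mulVec] at h1
  exact_mod_cast h1

/-- A unitary matrix preserves the Euclidean norm of an eigenvector, so each of the n roots of the
characteristic polynomial has modulus 1. -/
theorem eigenvalueQuasinorm_fourierOperator_pow {n : ℕ} (hn : 1 ≤ n) (m : ℕ) {p : ℝ≥0∞} :
    eigenvalueQuasinorm p (fourierOperator n ^ m) = (n : ℝ≥0∞) ^ (1 / p.toReal) := by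
  have hU := pow_mem (fourierMatrix_mem_unitaryGroup hn) m
  unfold eigenvalueQuasinorm
  rw [fourierOperator_pow]
  congr 1
  set T : EllOne n →ₗ[ℂ] EllOne n := Matrix.toLpLin 1 1 (fourierMatrix n ^ m) with hT
  have hz : ∀ z ∈ T.charpoly.roots, ‖z‖ₑ ^ p.toReal = 1 := by
    intro z hz
    have hroot := (Polynomial.mem_roots'.1 hz).2
    have hev : Module.End.HasEigenvalue T z := (Module.End.hasEigenvalue_iff_isRoot_charpoly _ _).2 hroot
    obtain ⟨v, hv⟩ := hev.exists_hasEigenvector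
    have h1 : (fourierMatrix n ^ m).mulVec v.ofLp = z • v.ofLp := by
      have := congrArg WithLp.ofLp hv.apply_eq_smul
      rwa [hT, Matrix.toLpLin_apply] at this
    have h2 : star ((fourierMatrix n ^ m).mulVec v.ofLp) ⬝ᵥ (fourierMatrix n ^ m).mulVec v.ofLp
        = star v.ofLp ⬝ᵥ v.ofLp := by
      rw [Matrix.star_mulVec, Matrix.dotProduct_mulVec, Matrix.vecMul_vecMul,
        ← Matrix.star_eq_conjTranspose, Matrix.mem_unitaryGroup_iff'.1 hU, Matrix.vecMul_one]
    have hv0 : star v.ofLp ⬝ᵥ v.ofLp ≠ 0 := by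
      open scoped ComplexOrder in
      rw [Ne, dotProduct_star_self_eq_zero, WithLp.ofLp_eq_zero]
      exact hv.2
    rw [h1, star_smul, smul_dotProduct, dotProduct_smul, smul_smul, smul_eq_mul] at h2
    have h3 := mul_right_cancel₀ hv0 (h2.trans (one_mul _).symm)
    rw [RCLike.star_def, RCLike.conj_mul] at h3
    have h4 : ‖z‖ ^ 2 = 1 := by
      apply Complex.ofReal_injective
      simpa using h3
    have h5 : ‖z‖ = 1 := (pow_eq_one_iff_of_nonneg (norm_nonneg z) two_ne_zero).1 h4
    rw [← ofReal_norm, h5]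
    simp
  rw [Multiset.map_congr rfl hz, Multiset.map_const', Multiset.sum_replicate, nsmul_eq_mul, mul_one,
    IsAlgClosed.card_roots_eq_natDegree, LinearMap.charpoly_natDegree,
    (WithLp.linearEquiv 1 ℂ (Fin n → ℂ)).finrank_eq, Module.finrank_fin_fun]

/-! ### Determinants of operators in `l_1^n` that factor through a Hilbert space -/

/-- The identity map from `l_2^n` to `l_1^n`. -/
def euclideanToEllOne (n : ℕ) : EuclideanSpace ℂ (Fin n) ≃ₗ[ℂ] EllOne n :=
  (WithLp.linearEquiv 2 ℂ (Fin n → ℂ)).trans (WithLp.linearEquiv 1 ℂ (Fin n → ℂ)).symm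

theorem EllOne.norm_eq {n : ℕ} (y : EllOne n) : ‖y‖ = ∑ i, ‖y i‖ := by
  rw [PiLp.norm_eq_sum (by simp)]
  simp

theorem EllOne.norm_single {n : ℕ} (i : Fin n) :
    ‖(WithLp.toLp 1 (Pi.single i (1 : ℂ)) : EllOne n)‖ = 1 := by
  simp

/-- Operators from a Hilbert space to `l_1^n` are Hilbert-Schmidt as operators to `l_2^n`. -/
theorem sum_norm_sq_le_opNorm_sq {n : ℕ} (hn : 1 ≤ n) {H ι : Type*} [NormedAddCommGroup H]
    [InnerProductSpace ℂ H] [Fintype ι] (B : H →L[ℂ] EllOne n) {g : ι → H}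
    (hg : Orthonormal ℂ g) :
    ∑ k, ‖(euclideanToEllOne n).symm (B (g k))‖ ^ 2 ≤ ‖B‖ ^ 2 := by
  have hn0 : (0 : ℝ) < n := by exact_mod_cast hn
  -- Applying the Fourier matrix after `B` leaves the Hilbert-Schmidt norm into l_2^n unchanged. Its
  -- flat entries give each of the n coordinate functionals norm at most n^(-1/2) ‖B‖, so the
  -- squares sum to at most ‖B‖².
  let φ : Fin n → H →ₗ[ℂ] ℂ := fun l =>
    { toFun := fun x => ∑ i, fourierMatrix n l i * B x i
      map_add' := fun x y => by simp [mul_add, Finset.sum_add_distrib]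
      map_smul' := fun c x => by
        simp only [map_smul, PiLp.smul_apply, smul_eq_mul, RingHom.id_apply, Finset.mul_sum]
        exact Finset.sum_congr rfl fun i _ => by ring }
  have hφ : ∀ l x, ‖φ l x‖ ≤ (Real.sqrt n)⁻¹ * ‖B‖ * ‖x‖ := by
    intro l x
    calc ‖φ l x‖ ≤ ∑ i, ‖fourierMatrix n l i * B x i‖ :=
          norm_sum_le Finset.univ fun i => fourierMatrix n l i * B x i
      _ = (Real.sqrt n)⁻¹ * ‖B x‖ := by
        simp only [norm_mul, norm_fourierMatrix_apply, EllOne.norm_eq, Finset.mul_sum]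
      _ ≤ (Real.sqrt n)⁻¹ * (‖B‖ * ‖x‖) := by
        gcongr
        exact B.le_opNorm x
      _ = _ := by ring
  have hl : ∀ l, ∑ k, ‖φ l (g k)‖ ^ 2 ≤ (n : ℝ)⁻¹ * ‖B‖ ^ 2 := by
    intro l
    set S := ∑ k, ‖φ l (g k)‖ ^ 2 with hS
    have hS0 : 0 ≤ S := by positivity
    -- The Riesz vector of φ l on the span of g: both φ l x and ‖x‖² equal S, which yields Bessel's
    -- inequality without completeness of `H`.
    let x : H := ∑ k, (starRingEnd ℂ) (φ l (g k)) • g k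
    have hx1 : φ l x = (S : ℂ) := by
      simp only [x, map_sum, map_smul, smul_eq_mul, RCLike.conj_mul, hS]
      push_cast
      rfl
    have hx2 : ‖x‖ ^ 2 = S := by
      have h1 : (inner ℂ x x : ℂ) = ∑ k, (starRingEnd ℂ) ((starRingEnd ℂ) (φ l (g k))) *
          (starRingEnd ℂ) (φ l (g k)) := hg.inner_sum _ _ _
      rw [inner_self_eq_norm_sq_to_K] at h1
      simp only [RCLike.conj_mul, RCLike.norm_conj] at h1
      apply Complex.ofReal_injective
      rw [hS]
      push_cast
      exact h1
    have h := hφ l x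
    rw [hx1, Complex.norm_real, Real.norm_of_nonneg hS0] at h
    rcases hS0.eq_or_lt with h0 | h0
    · rw [← h0]
      positivity
    · have hsq : S ^ 2 ≤ ((Real.sqrt n)⁻¹ * ‖B‖ * ‖x‖) ^ 2 := by gcongr
      rw [mul_pow, mul_pow, hx2, inv_pow, Real.sq_sqrt hn0.le, sq S] at hsq
      exact le_of_mul_le_mul_right hsq h0
  calc ∑ k, ‖(euclideanToEllOne n).symm (B (g k))‖ ^ 2
      = ∑ k, ∑ l, ‖φ l (g k)‖ ^ 2 := by
        refine Finset.sum_congr rfl fun k _ => ?_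
        rw [EuclideanSpace.norm_sq_eq]
        exact (sum_norm_sq_fourierMatrix_transform hn fun i => B (g k) i).symm
    _ = ∑ l, ∑ k, ‖φ l (g k)‖ ^ 2 := Finset.sum_comm
    _ ≤ ∑ l : Fin n, (n : ℝ)⁻¹ * ‖B‖ ^ 2 := Finset.sum_le_sum fun l _ => hl l
    _ = ‖B‖ ^ 2 := by
      rw [Finset.sum_const, Finset.card_univ, Fintype.card_fin, nsmul_eq_mul]
      field_simp

/-- Volume factors multiply along a composition when each map is restricted to the range of the
previous one. The three factors are bounded by the columns of `A`, the singular numbers of `U`, and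
the Hilbert-Schmidt norm of `B`; the last supplies the gain n^(-1/2). -/
theorem enorm_det_le_of_factorization {n : ℕ} (hn : 1 ≤ n) {H : Type*} [NormedAddCommGroup H]
    [InnerProductSpace ℂ H] (A : EllOne n →L[ℂ] H) (U : H →L[ℂ] H) (B : H →L[ℂ] EllOne n) :
    ‖LinearMap.det ((B ∘L U ∘L A : EllOne n →L[ℂ] EllOne n) : EllOne n →ₗ[ℂ] EllOne n)‖ₑ
      ≤ (‖A‖ₑ * ‖B‖ₑ / (n : ℝ≥0∞) ^ (1 / 2 : ℝ)) ^ n *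
        ∏ k ∈ Finset.range n, singularNumber U k := by
  have hn0 : (0 : ℝ) < n := by exact_mod_cast hn
  set T : EllOne n →ₗ[ℂ] EllOne n := ((B ∘L U ∘L A : EllOne n →L[ℂ] EllOne n) :
    EllOne n →ₗ[ℂ] EllOne n) with hT
  -- Off this trivial case all the restricted maps are injective, so both intermediate ranges have
  -- dimension exactly n.
  by_cases hdet : LinearMap.det T = 0
  · simp [hdet]
  set e := euclideanToEllOne n with he
  let a : EuclideanSpace ℂ (Fin n) →ₗ[ℂ] H := (A : EllOne n →ₗ[ℂ] H) ∘ₗ e.toLinearMap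
  let b : H →ₗ[ℂ] EuclideanSpace ℂ (Fin n) := e.symm.toLinearMap ∘ₗ (B : H →ₗ[ℂ] EllOne n)
  let u : H →ₗ[ℂ] H := U
  have hdet' : (b ∘ₗ (u ∘ₗ a)).normDet = ‖LinearMap.det T‖ := by
    rw [LinearMap.normDet_eq_norm_det, ← LinearMap.det_conj T e.symm]
    rfl
  have hinj : Function.Injective (b ∘ₗ (u ∘ₗ a)) := by
    have h0 : (b ∘ₗ (u ∘ₗ a)).normDet ≠ 0 := by rwa [hdet', norm_ne_zero_iff]
    exact ((LinearMap.normDet_ne_zero_tfae _).out 0 4).1 h0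
  have hinj1 : Function.Injective (u ∘ₗ a) :=
    Function.Injective.of_comp (f := b) (by simpa using hinj)
  have hinj2 : Function.Injective a := Function.Injective.of_comp (f := u) (by simpa using hinj1)
  have hr1 : Module.finrank ℂ (LinearMap.range (u ∘ₗ a)) = n := by
    rw [LinearMap.finrank_range_of_inj hinj1, finrank_euclideanSpace_fin]
  have hr2 : Module.finrank ℂ (LinearMap.range a) = n := by
    rw [LinearMap.finrank_range_of_inj hinj2, finrank_euclideanSpace_fin]
  have hA : a.normDet ^ 2 ≤ (‖A‖ ^ 2) ^ n := by
    refine (a.normDet_sq_le (EuclideanSpace.basisFun (Fin n) ℂ)).trans ?_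
    rw [Fintype.card_fin]
    gcongr
    rw [div_le_iff₀ hn0]
    calc _ ≤ ∑ i : Fin n, ‖A‖ ^ 2 := by
          refine Finset.sum_le_sum fun i _ => ?_
          gcongr
          have h := A.le_opNorm (WithLp.toLp 1 (Pi.single i (1 : ℂ)))
          rw [EllOne.norm_single, mul_one] at h
          rw [EuclideanSpace.basisFun_apply]
          exact h
      _ = _ := by
        rw [Finset.sum_const, Finset.card_univ, Fintype.card_fin, nsmul_eq_mul]
        ring
  have hB : (b.domRestrict (LinearMap.range (u ∘ₗ a))).normDet ^ 2 ≤ (‖B‖ ^ 2 / n) ^ n := by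
    set g := (stdOrthonormalBasis ℂ (LinearMap.range (u ∘ₗ a))).reindex (finCongr hr1) with hg
    refine ((b.domRestrict (LinearMap.range (u ∘ₗ a))).normDet_sq_le g).trans ?_
    rw [Fintype.card_fin]
    gcongr
    exact sum_norm_sq_le_opNorm_sq hn B
      (g.orthonormal.comp_linearIsometry (LinearMap.range (u ∘ₗ a)).subtypeₗᵢ)
  have hA' : a.normDet ≤ ‖A‖ ^ n := by
    refine le_of_sq_le_sq ?_ (by positivity)
    rwa [← pow_mul, mul_comm, pow_mul]
  have hB' : (b.domRestrict (LinearMap.range (u ∘ₗ a))).normDet ≤ (‖B‖ / Real.sqrt n) ^ n := by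
    refine le_of_sq_le_sq ?_ (by positivity)
    rwa [← pow_mul, mul_comm, pow_mul, div_pow, Real.sq_sqrt hn0.le]
  have hU := normDet_domRestrict_le U (LinearMap.range a)
  rw [hr2] at hU
  rw [← ofReal_norm, ← hdet', LinearMap.normDet_comp, LinearMap.normDet_comp a u,
    mul_left_comm, ENNReal.ofReal_mul (LinearMap.normDet_nonneg _), mul_comm]
  refine mul_le_mul' ?_ hU
  calc ENNReal.ofReal _ ≤ ENNReal.ofReal ((‖B‖ / Real.sqrt n) ^ n * ‖A‖ ^ n) := by
        apply ENNReal.ofReal_le_ofReal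
        have := LinearMap.normDet_nonneg a
        gcongr
    _ = _ := by
      rw [← mul_pow, ENNReal.ofReal_pow (by positivity), ENNReal.ofReal_mul (by positivity),
        ENNReal.ofReal_div_of_pos (by positivity), ofReal_norm, ofReal_norm, Real.sqrt_eq_rpow,
        ← ENNReal.ofReal_rpow_of_pos hn0, ENNReal.ofReal_natCast]
      congr 1
      rw [mul_comm, mul_div_assoc]

/-- Lower bound for the factorization quasinorm by the determinant. -/
theorem le_schattenFactorization_of_norm_det_eq_one {n : ℕ} (hn : 1 ≤ n) {t : ℝ≥0∞} (ht : 0 < t)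
    {T : EllOne n →L[ℂ] EllOne n}
    (hT : ‖LinearMap.det (T : EllOne n →ₗ[ℂ] EllOne n)‖ = 1) :
    (n : ℝ≥0∞) ^ ((t⁻¹).toReal + 1 / 2) ≤ schattenFactorization t T := by
  have hn0 : (n : ℝ≥0∞) ≠ 0 := by exact_mod_cast (by omega : n ≠ 0)
  have hnt : (n : ℝ≥0∞) ≠ ∞ := ENNReal.natCast_ne_top n
  unfold schattenFactorization
  refine le_iInf fun H => le_iInf fun _ => le_iInf fun _ => le_iInf fun _ => le_iInf fun A =>
    le_iInf fun U => le_iInf fun B => le_iInf fun hU => le_iInf fun hTBUA => ?_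
  have h := enorm_det_le_of_factorization hn A U B
  rw [← hTBUA, ← ofReal_norm, hT, ENNReal.ofReal_one] at h
  have h1 := h.trans (mul_le_mul' le_rfl (prod_range_le_lpQuasinorm hn ht (singularNumber U)))
  rw [← mul_pow] at h1
  -- Both factors are n-th powers, so the determinant estimate loses nothing on taking the n-th
  -- root.
  have h2 := (one_le_pow_iff (by omega : n ≠ 0)).1 h1
  rw [ENNReal.rpow_add _ _ hn0 hnt]
  have e1 : (n : ℝ≥0∞) ^ (1 / 2 : ℝ) ≠ 0 := by simp [ENNReal.rpow_eq_zero_iff, hn0, hnt]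
  have e2 : (n : ℝ≥0∞) ^ (1 / 2 : ℝ) ≠ ∞ := ENNReal.rpow_ne_top_of_nonneg (by norm_num) hnt
  have e3 : (n : ℝ≥0∞) ^ (t⁻¹).toReal ≠ 0 := by simp [ENNReal.rpow_eq_zero_iff, hn0, hnt]
  have e4 : (n : ℝ≥0∞) ^ (t⁻¹).toReal ≠ ∞ := ENNReal.rpow_ne_top_of_nonneg (by simp) hnt
  rw [← ENNReal.mul_div_mul_comm (Or.inl e1) (Or.inl e2),
    ENNReal.le_div_iff_mul_le (Or.inl (mul_ne_zero e1 e3)) (Or.inl (ENNReal.mul_ne_top e2 e4)),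
    one_mul] at h2
  rw [mul_comm]
  refine h2.trans (le_of_eq ?_)
  rw [schattenQuasinorm]
  ring

/-! ### Singular numbers of diagonal operators -/

/-- The diagonal operator in `l_2^N` with diagonal `d`. -/
noncomputable def diagonalOperator {N : ℕ} (d : Fin N → ℂ) :
    EuclideanSpace ℂ (Fin N) →L[ℂ] EuclideanSpace ℂ (Fin N) :=
  LinearMap.toContinuousLinearMap
    { toFun := fun x => WithLp.toLp 2 fun k => d k * x k
      map_add' := fun x y => by ext k; simp [mul_add]
      map_smul' := fun c x => by ext k; simp [mul_left_comm] }

@[simp]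
theorem diagonalOperator_apply {N : ℕ} (d : Fin N → ℂ) (x : EuclideanSpace ℂ (Fin N))
    (k : Fin N) : diagonalOperator d x k = d k * x k := rfl

theorem rank_diagonalOperator_le {N k : ℕ} (d : Fin N → ℂ) (hd : ∀ j : Fin N, k ≤ j → d j = 0) :
    LinearMap.rank (diagonalOperator d :
      EuclideanSpace ℂ (Fin N) →ₗ[ℂ] EuclideanSpace ℂ (Fin N)) ≤ k := by
  let P : EuclideanSpace ℂ (Fin N) →ₗ[ℂ] (Fin k → ℂ) :=
    { toFun := fun x i => if h : (i : ℕ) < N then x ⟨i, h⟩ else 0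
      map_add' := fun x y => by ext i; by_cases h : (i : ℕ) < N <;> simp [h]
      map_smul' := fun c x => by ext i; by_cases h : (i : ℕ) < N <;> simp [h] }
  let Q : (Fin k → ℂ) →ₗ[ℂ] EuclideanSpace ℂ (Fin N) :=
    { toFun := fun c => WithLp.toLp 2 fun j => if h : (j : ℕ) < k then d j * c ⟨j, h⟩ else 0
      map_add' := fun x y => by ext j; by_cases h : (j : ℕ) < k <;> simp [h, mul_add]
      map_smul' := fun c x => by ext j; by_cases h : (j : ℕ) < k <;> simp [h, mul_left_comm] }
  have h : (diagonalOperator d : EuclideanSpace ℂ (Fin N) →ₗ[ℂ] EuclideanSpace ℂ (Fin N))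
      = Q ∘ₗ P := by
    ext x j
    by_cases h : (j : ℕ) < k
    · simp [P, Q, h]
    · simp [P, Q, h, hd j (not_lt.1 h)]
  rw [h]
  calc _ ≤ LinearMap.rank Q := LinearMap.rank_comp_le_left P Q
    _ ≤ Module.rank ℂ (Fin k → ℂ) := LinearMap.rank_le_domain Q
    _ = k := rank_fin_fun k

theorem norm_diagonalOperator_le {N : ℕ} (d : Fin N → ℂ) {c : ℝ} (hc : 0 ≤ c)
    (hd : ∀ j, ‖d j‖ ≤ c) : ‖diagonalOperator d‖ ≤ c := by
  refine ContinuousLinearMap.opNorm_le_bound _ hc fun x => ?_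
  refine le_of_sq_le_sq ?_ (by positivity)
  rw [mul_pow, EuclideanSpace.norm_sq_eq, EuclideanSpace.norm_sq_eq, Finset.mul_sum]
  refine Finset.sum_le_sum fun j _ => ?_
  rw [diagonalOperator_apply, norm_mul, mul_pow]
  gcongr
  exact hd j

theorem singularNumber_diagonalOperator_le {N : ℕ} (d : Fin N → ℂ)
    (hd : Antitone fun j => ‖d j‖) (k : Fin N) :
    singularNumber (diagonalOperator d) k ≤ ‖d k‖ₑ := by
  -- Truncation to the first k entries; the remainder is diagonal with entries at most |d k| by
  -- monotonicity.
  let F := diagonalOperator fun j : Fin N => if (j : ℕ) < k then d j else 0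
  refine (iInf₂_le F (rank_diagonalOperator_le _ fun j hj => by simp [not_lt.2 hj])).trans ?_
  have h : diagonalOperator d - F = diagonalOperator fun j : Fin N =>
      if (j : ℕ) < k then 0 else d j := by
    ext x j
    simp only [F, _root_.sub_apply, PiLp.sub_apply, diagonalOperator_apply]
    split_ifs <;> simp
  rw [h, ← ofReal_norm, ← ofReal_norm]
  refine ENNReal.ofReal_le_ofReal (norm_diagonalOperator_le _ (norm_nonneg _) fun j => ?_)
  by_cases hj : (j : ℕ) < k
  · simp [hj]
  · simpa [hj] using hd (Fin.le_def.2 (not_lt.1 hj))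

/-! ### The determinant and finite `(s;2)`-nuclear representations -/

/-- Split a_k = d_k c_k with |d_k| = |a_k|^(1-s/2) and |c_k|² = |a_k|^s, and factor T through l_2^N
as the weighted functionals, the diagonal operator d, and synthesis along y. The three parts are
controlled by (∑ |a_k|^s)^(1/2), the numbers |a_k|^(1-s/2), and the weak l_2 bound on y. -/
theorem enorm_det_le_of_antitone {n N : ℕ} (hn : 1 ≤ n) (hN : n ≤ N) {s : ℝ} (hs : 0 < s)
    (hs2 : s ≤ 2) (a : Fin N → ℂ) (x' : Fin N → StrongDual ℂ (EllOne n)) (y : Fin N → EllOne n)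
    (hx : ∀ k, ‖x' k‖ ≤ 1)
    (hy : ∀ y' : StrongDual ℂ (EllOne n), ‖y'‖ ≤ 1 → ∑ k, ‖y' (y k)‖ ^ 2 ≤ 1)
    (ha : Antitone fun k => ‖a k‖) {T : EllOne n →ₗ[ℂ] EllOne n}
    (hT : ∀ x, T x = ∑ k, (a k * x' k x) • y k) :
    ‖LinearMap.det T‖ₑ ≤ ((∑ k, ‖a k‖ₑ ^ s) / n) ^ (n / s : ℝ) := by
  set r : ℝ := 1 - s / 2 with hr
  have hr0 : 0 ≤ r := by rw [hr]; linarith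
  -- For s = 2 the exponent r is 0 and every d k is 1, even where a k = 0.
  let d : Fin N → ℂ := fun k => ((‖a k‖ ^ r : ℝ) : ℂ)
  let c : Fin N → ℂ := fun k => a k / ((‖a k‖ ^ r : ℝ) : ℂ)
  have hdc : ∀ k, d k * c k = a k := by
    intro k
    by_cases h : a k = 0
    · simp [c, h]
    · have : (((‖a k‖ ^ r : ℝ)) : ℂ) ≠ 0 := by
        exact_mod_cast (Real.rpow_pos_of_pos (norm_pos_iff.2 h) r).ne'
      exact mul_div_cancel₀ _ this
  have hd : ∀ k, ‖d k‖ = ‖a k‖ ^ r := fun k => by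
    rw [Complex.norm_real, Real.norm_of_nonneg (by positivity)]
  have hc : ∀ k, ‖c k‖ ^ 2 = ‖a k‖ ^ s := by
    intro k
    by_cases h : a k = 0
    · simp [c, h, Real.zero_rpow hs.ne']
    · have hpos := norm_pos_iff.2 h
      have h1 : ‖c k‖ = ‖a k‖ ^ (1 - r) := by
        rw [Real.rpow_sub hpos, Real.rpow_one, norm_div]
        exact congrArg _ (hd k)
      rw [h1, ← Real.rpow_natCast, ← Real.rpow_mul hpos.le, hr]
      congr 1
      push_cast
      ring
  let A : EllOne n →L[ℂ] EuclideanSpace ℂ (Fin N) := LinearMap.toContinuousLinearMap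
    { toFun := fun x => WithLp.toLp 2 fun k => c k * x' k x
      map_add' := fun x y => by ext k; simp [mul_add]
      map_smul' := fun c x => by ext k; simp [mul_left_comm] }
  let B : EuclideanSpace ℂ (Fin N) →L[ℂ] EllOne n := LinearMap.toContinuousLinearMap
    { toFun := fun z => ∑ k, z k • y k
      map_add' := fun x y => by simp [add_smul, Finset.sum_add_distrib]
      map_smul' := fun c x => by simp [mul_smul, Finset.smul_sum] }
  have hTeq : T = ((B ∘L diagonalOperator d ∘L A : EllOne n →L[ℂ] EllOne n) :
      EllOne n →ₗ[ℂ] EllOne n) := by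
    ext1 x
    rw [hT]
    change _ = ∑ k, (d k * (c k * x' k x)) • y k
    exact Finset.sum_congr rfl fun k _ => by rw [← mul_assoc, hdc]
  have hA : ‖A‖ ≤ (∑ k, ‖a k‖ ^ s) ^ (1 / 2 : ℝ) := by
    refine ContinuousLinearMap.opNorm_le_bound _ (by positivity) fun x => ?_
    refine le_of_sq_le_sq ?_ (by positivity)
    rw [mul_pow, ← Real.sqrt_eq_rpow, Real.sq_sqrt (by positivity), EuclideanSpace.norm_sq_eq,
      Finset.sum_mul]
    refine Finset.sum_le_sum fun k _ => ?_
    change ‖c k * x' k x‖ ^ 2 ≤ _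
    rw [norm_mul, mul_pow, hc]
    gcongr
    simpa using (x' k).le_of_opNorm_le (hx k) x
  have hB : ‖B‖ ≤ 1 := by
    refine ContinuousLinearMap.opNorm_le_bound _ zero_le_one fun z => ?_
    -- A norming functional and Cauchy-Schwarz turn the weak l_2 hypothesis into the operator bound.
    obtain ⟨y', hy', hyz⟩ := exists_dual_vector'' ℂ (B z)
    have h1 : ‖B z‖ = ‖∑ k, z k * y' (y k)‖ := by
      have h2 : y' (B z) = ∑ k, z k * y' (y k) := by
        change y' (∑ k, z k • y k) = _
        simp [map_sum]
      rw [← h2, hyz]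
      simp
    rw [h1, one_mul]
    refine le_of_sq_le_sq ?_ (norm_nonneg _)
    calc ‖∑ k, z k * y' (y k)‖ ^ 2 ≤ (∑ k, ‖z k‖ * ‖y' (y k)‖) ^ 2 := by
          gcongr
          exact norm_sum_le_of_le _ fun k _ => norm_mul_le _ _
      _ ≤ (∑ k, ‖z k‖ ^ 2) * ∑ k, ‖y' (y k)‖ ^ 2 := Finset.sum_mul_sq_le_sq_mul_sq _ _ _
      _ ≤ (∑ k, ‖z k‖ ^ 2) * 1 := by
          gcongr
          exact hy y' hy'
      _ = ‖z‖ ^ 2 := by rw [mul_one, EuclideanSpace.norm_sq_eq]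
  set S : ℝ≥0∞ := ∑ k, ‖a k‖ₑ ^ s with hS
  have hAe : ‖A‖ₑ ≤ S ^ (1 / 2 : ℝ) := by
    rw [← ofReal_norm]
    refine (ENNReal.ofReal_le_ofReal hA).trans (le_of_eq ?_)
    rw [← ENNReal.ofReal_rpow_of_nonneg (by positivity) (by norm_num),
      ENNReal.ofReal_sum_of_nonneg fun _ _ => by positivity, hS]
    congr 1
    refine Finset.sum_congr rfl fun k _ => ?_
    rw [← ENNReal.ofReal_rpow_of_nonneg (norm_nonneg _) hs.le, ofReal_norm]
  have hBe : ‖B‖ₑ ≤ 1 := by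
    rw [← ofReal_norm]
    exact ENNReal.ofReal_le_one.2 hB
  have hprod : ∏ k ∈ Finset.range n, singularNumber (diagonalOperator d) k
      ≤ ((S / n) ^ n) ^ (r / s) := by
    calc _ = ∏ k : Fin n, singularNumber (diagonalOperator d) k :=
          (Fin.prod_univ_eq_prod_range _ n).symm
      -- Written as powers of |a_k|^s so that the mean inequality produces the same sum as the bound
      -- for `A`.
      _ ≤ ∏ k : Fin n, (‖a (Fin.castLE hN k)‖ₑ ^ s) ^ (r / s) := by
        refine Finset.prod_le_prod' fun k _ => ?_
        refine (singularNumber_diagonalOperator_le d ?_ (Fin.castLE hN k)).trans (le_of_eq ?_)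
        · intro i j hij
          simp only [hd]
          exact Real.rpow_le_rpow (norm_nonneg _) (ha hij) hr0
        · rw [← ofReal_norm, hd, ← ENNReal.ofReal_rpow_of_nonneg (norm_nonneg _) hr0, ofReal_norm,
            ← ENNReal.rpow_mul, mul_div_cancel₀ _ hs.ne']
      _ = (∏ k : Fin n, ‖a (Fin.castLE hN k)‖ₑ ^ s) ^ (r / s) :=
        ENNReal.prod_rpow_of_nonneg (by positivity)
      _ ≤ _ := by
        gcongr
        refine (ENNReal.prod_le_sum_div_card_pow _ _).trans ?_
        rw [Finset.card_univ, Fintype.card_fin]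
        gcongr
        exact (Finset.sum_map Finset.univ (Fin.castLEEmb hN) fun k => ‖a k‖ₑ ^ s).symm.trans_le
          (Finset.sum_le_sum_of_subset (Finset.subset_univ _))
  rw [hTeq]
  refine (enorm_det_le_of_factorization hn A (diagonalOperator d) B).trans ?_
  calc _ ≤ (S ^ (1 / 2 : ℝ) * 1 / (n : ℝ≥0∞) ^ (1 / 2 : ℝ)) ^ n * ((S / n) ^ n) ^ (r / s) := by
        gcongr
    _ = (S / n) ^ (n / s : ℝ) := by
      rw [mul_one, ← ENNReal.div_rpow_of_nonneg _ _ (by norm_num), ← ENNReal.rpow_natCast,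
        ← ENNReal.rpow_natCast, ← ENNReal.rpow_mul, ← ENNReal.rpow_mul,
        ← ENNReal.rpow_add_of_nonneg _ _ (by positivity) (by positivity)]
      -- The exponents match because 1/2 + (1 - s/2)/s = 1/s.
      congr 1
      rw [hr]
      field_simp
      ring

theorem enorm_det_le_of_sum {n N : ℕ} (hn : 1 ≤ n) (hN : n ≤ N) {s : ℝ} (hs : 0 < s)
    (hs2 : s ≤ 2) (a : Fin N → ℂ) (x' : Fin N → StrongDual ℂ (EllOne n)) (y : Fin N → EllOne n)
    (hx : ∀ k, ‖x' k‖ ≤ 1)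
    (hy : ∀ y' : StrongDual ℂ (EllOne n), ‖y'‖ ≤ 1 → ∑ k, ‖y' (y k)‖ ^ 2 ≤ 1)
    {T : EllOne n →ₗ[ℂ] EllOne n} (hT : ∀ x, T x = ∑ k, (a k * x' k x) • y k) :
    ‖LinearMap.det T‖ₑ ≤ ((∑ k, ‖a k‖ₑ ^ s) / n) ^ (n / s : ℝ) := by
  -- The hypotheses and the bound are invariant under permutation; the sign makes the increasing
  -- sort put the moduli in decreasing order.
  let σ : Equiv.Perm (Fin N) := Tuple.sort fun k => -‖a k‖
  have hσ := Tuple.monotone_sort fun k => -‖a k‖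
  rw [← Equiv.sum_comp σ fun k => ‖a k‖ₑ ^ s]
  refine enorm_det_le_of_antitone hn hN hs hs2 (a ∘ σ) (x' ∘ σ) (y ∘ σ) (fun k => hx _)
    (fun y' hy' => ?_) (fun i j hij => neg_le_neg_iff.1 (hσ hij)) fun x => ?_
  · exact (Equiv.sum_comp σ fun k => ‖y' (y k)‖ ^ 2).trans_le (hy y' hy')
  · rw [hT]
    exact (Equiv.sum_comp σ fun k => (a k * x' k x) • y k).symm

/-! ### Lower bound of the `(p;2)`-nuclear quasinorm -/

theorem ENNReal.rpow_le_one_iff_of_pos {x : ℝ≥0∞} {z : ℝ} (hz : 0 < z) : x ^ z ≤ 1 ↔ x ≤ 1 := by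
  simpa using ENNReal.rpow_le_rpow_iff (x := x) (y := 1) hz

/-- Exhibits the determinant as a continuous function of the images of the unit vectors, so
pointwise convergence of operators is enough to pass to the limit. -/
theorem EllOne.det_eq {n : ℕ} (f : EllOne n →ₗ[ℂ] EllOne n) :
    LinearMap.det f =
      (Matrix.of fun i j => f (WithLp.toLp 1 (Pi.single j (1 : ℂ))) i).det := by
  obtain ⟨M, rfl⟩ := (Matrix.toLpLin (1 : ℝ≥0∞) (1 : ℝ≥0∞)).surjective f
  rw [LinearMap.det_toLpLin]
  congr 1
  ext i j
  simp

/-- The partial sums of a representation satisfy the finite determinant bound with the full sum S on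
the right, and their determinants converge to that of T. Hence 1 ≤ (S/n)^(n/p), that is, S ≥ n. -/
theorem le_nuclearTwoQuasinorm_of_norm_det_eq_one {n : ℕ} (hn : 1 ≤ n) {p : ℝ≥0∞} (hp : 0 < p)
    (hp2 : p ≤ 2) {T : EllOne n →L[ℂ] EllOne n}
    (hT : ‖LinearMap.det (T : EllOne n →ₗ[ℂ] EllOne n)‖ = 1) :
    (n : ℝ≥0∞) ^ (p⁻¹).toReal ≤ nuclearTwoQuasinorm p T := by
  have hn0 : (n : ℝ≥0∞) ≠ 0 := by exact_mod_cast (by omega : n ≠ 0)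
  have hnt : (n : ℝ≥0∞) ≠ ∞ := ENNReal.natCast_ne_top n
  have hpt : p ≠ ∞ := (hp2.trans_lt (by simp)).ne
  have hs : 0 < p.toReal := ENNReal.toReal_pos hp.ne' hpt
  have hs2 : p.toReal ≤ 2 := by simpa using ENNReal.toReal_mono (by simp) hp2
  refine le_iInf fun a => le_iInf fun x' => le_iInf fun y => le_iInf fun hx => le_iInf fun hy =>
    le_iInf fun hsum => ?_
  rw [lpQuasinorm, if_neg hpt, ENNReal.toReal_inv, ← one_div]
  gcongr
  set S := ∑' k, ‖a k‖ₑ ^ p.toReal with hS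
  let F : ℕ → EllOne n →ₗ[ℂ] EllOne n := fun N =>
    ∑ k ∈ Finset.range N, (a k • (x' k : EllOne n →ₗ[ℂ] ℂ)).smulRight (y k)
  have hF : ∀ N x, F N x = ∑ k ∈ Finset.range N, (a k * x' k x) • y k := by
    intro N x
    simp [F]
  have hlim : Filter.Tendsto (fun N => ‖LinearMap.det (F N)‖ₑ) Filter.atTop
      (nhds ‖LinearMap.det (T : EllOne n →ₗ[ℂ] EllOne n)‖ₑ) := by
    refine (continuous_enorm.tendsto _).comp ?_
    simp only [EllOne.det_eq]
    refine ((continuous_id.matrix_det).tendsto _).comp ?_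
    refine tendsto_pi_nhds.2 fun i => tendsto_pi_nhds.2 fun j => ?_
    simp only [Matrix.of_apply, hF]
    exact ((PiLp.continuous_apply 1 (fun _ : Fin n => ℂ) i).tendsto _).comp
      (hsum _).tendsto_sum_nat
  have hbound : ∀ᶠ N in Filter.atTop,
      ‖LinearMap.det (F N)‖ₑ ≤ (S / n) ^ (n / p.toReal : ℝ) := by
    filter_upwards [Filter.eventually_ge_atTop n] with N hN
    refine (enorm_det_le_of_sum hn hN hs hs2 (fun k => a k) (fun k => x' k) (fun k => y k)
      (fun k => hx k) (fun y' hy' => ?_) (fun x => ?_)).trans ?_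
    · have h1 : lpQuasinorm 2 (fun k => ‖y' (y k)‖ₑ) ≤ 1 := (le_iSup₂_of_le y' hy' le_rfl).trans hy
      rw [lpQuasinorm, if_neg (by simp)] at h1
      have h2 := (ENNReal.rpow_le_one_iff_of_pos (by simp)).1 h1
      have h3 : ∑ k : Fin N, ‖y' (y k)‖ₑ ^ 2 ≤ 1 := by
        rw [Fin.sum_univ_eq_sum_range (fun k => ‖y' (y k)‖ₑ ^ 2) N]
        refine (ENNReal.sum_le_tsum _).trans ?_
        simpa using h2
      rw [← ENNReal.ofReal_le_one, ENNReal.ofReal_sum_of_nonneg fun _ _ => by positivity]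
      simpa [ENNReal.ofReal_pow] using h3
    · rw [hF, Fin.sum_univ_eq_sum_range (fun k => (a k * x' k x) • y k) N]
    · gcongr
      rw [Fin.sum_univ_eq_sum_range (fun k => ‖a k‖ₑ ^ p.toReal) N]
      exact ENNReal.sum_le_tsum _
  have h := le_of_tendsto hlim hbound
  have hpos : 0 < (n / p.toReal : ℝ) := by
    have : (0 : ℝ) < n := by exact_mod_cast hn
    positivity
  rw [← ofReal_norm, hT, ENNReal.ofReal_one, ← ENNReal.one_rpow (n / p.toReal : ℝ),
    ENNReal.rpow_le_rpow_iff hpos] at h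
  rwa [ENNReal.le_div_iff_mul_le (Or.inl hn0) (Or.inl hnt), one_mul] at h

/-! ### Upper bounds of the nuclear quasinorms of the Fourier operator -/

/-- Extension of a finite sequence by zeros. -/
def extendFin {n : ℕ} {M : Type*} [Zero M] (f : Fin n → M) (k : ℕ) : M :=
  if h : k < n then f ⟨k, h⟩ else 0

theorem extendFin_of_le {n k : ℕ} {M : Type*} [Zero M] (f : Fin n → M) (h : n ≤ k) :
    extendFin f k = 0 := dif_neg (not_lt.2 h)

theorem extendFin_coe {n : ℕ} {M : Type*} [Zero M] (f : Fin n → M) (k : Fin n) :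
    extendFin f k = f k := dif_pos k.2

theorem hasSum_of_forall_le_eq_zero {n : ℕ} {M : Type*} [AddCommMonoid M] [TopologicalSpace M]
    {f : ℕ → M} (hf : ∀ k, n ≤ k → f k = 0) : HasSum f (∑ k : Fin n, f k) := by
  rw [Fin.sum_univ_eq_sum_range f n]
  exact hasSum_sum_of_ne_finset_zero fun k hk => hf k (by simpa using hk)

theorem lpQuasinorm_le_of_forall_le_eq_zero {n : ℕ} {p : ℝ≥0∞} (hp : 0 < p) (hpt : p ≠ ∞)
    {f : ℕ → ℝ≥0∞} (hf : ∀ k, n ≤ k → f k = 0) {c : ℝ≥0∞} (hc : ∀ k : Fin n, f k ≤ c) :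
    lpQuasinorm p f ≤ (n : ℝ≥0∞) ^ (p⁻¹).toReal * c := by
  have hs : 0 < p.toReal := ENNReal.toReal_pos hp.ne' hpt
  have h := hasSum_of_forall_le_eq_zero (n := n) (f := fun k => f k ^ p.toReal) fun k hk => by
    simp [hf k hk, hs]
  rw [lpQuasinorm, if_neg hpt, h.tsum_eq, ENNReal.toReal_inv, ← one_div]
  calc _ ≤ (∑ k : Fin n, c ^ p.toReal) ^ (1 / p.toReal) := by
        gcongr with k
        exact hc k
    _ = _ := by
      rw [Finset.sum_const, Finset.card_univ, Fintype.card_fin, nsmul_eq_mul,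
        ENNReal.mul_rpow_of_nonneg _ _ (by positivity), ← ENNReal.rpow_mul,
        mul_one_div_cancel hs.ne', ENNReal.rpow_one]

/-- The rows of the Fourier matrix as functionals on `l_1^n`. -/
noncomputable def fourierRow (n : ℕ) (k : Fin n) : StrongDual ℂ (EllOne n) :=
  PiLp.proj 1 (fun _ : Fin n => ℂ) k ∘L fourierOperator n

theorem fourierRow_apply {n : ℕ} (k : Fin n) (x : EllOne n) :
    fourierRow n k x = fourierOperator n x k := rfl

theorem norm_fourierRow_le {n : ℕ} (k : Fin n) : ‖fourierRow n k‖ ≤ (Real.sqrt n)⁻¹ := by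
  refine ContinuousLinearMap.opNorm_le_bound _ (by positivity) fun x => ?_
  calc ‖fourierRow n k x‖ = ‖∑ l, fourierMatrix n k l * x l‖ := rfl
    _ ≤ ∑ l, ‖fourierMatrix n k l * x l‖ := norm_sum_le _ _
    _ = (Real.sqrt n)⁻¹ * ‖x‖ := by
      simp only [norm_mul, norm_fourierMatrix_apply, EllOne.norm_eq, Finset.mul_sum]

theorem EllOne.sum_smul_single {n : ℕ} (x : EllOne n) :
    ∑ k, x k • (WithLp.toLp 1 (Pi.single k (1 : ℂ)) : EllOne n) = x := by
  ext i
  simp [Finset.sum_apply, Pi.single_apply]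

/-- Expansion along the rows: n terms, each a row functional of norm at most n^(-1/2) times a unit
vector. -/
theorem nuclearQuasinorm_fourierOperator_le {n : ℕ} (hn : 1 ≤ n) {p : ℝ≥0∞} (hp : 0 < p)
    (hpt : p ≠ ∞) :
    nuclearQuasinorm p (fourierOperator n) ≤ (n : ℝ≥0∞) ^ ((p⁻¹).toReal - 1 / 2) := by
  have hn0 : (n : ℝ≥0∞) ≠ 0 := by exact_mod_cast (by omega : n ≠ 0)
  have hnt : (n : ℝ≥0∞) ≠ ∞ := ENNReal.natCast_ne_top n
  refine (iInf₂_le (extendFin (fourierRow n))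
    (extendFin fun k => (WithLp.toLp 1 (Pi.single k (1 : ℂ)) : EllOne n))).trans ?_
  refine (iInf_le _ fun x => ?_).trans ?_
  · have h := hasSum_of_forall_le_eq_zero (n := n) (f := fun k =>
      extendFin (fourierRow n) k x •
        extendFin (fun k => (WithLp.toLp 1 (Pi.single k (1 : ℂ)) : EllOne n)) k) fun k hk => by
      simp [extendFin_of_le _ hk]
    simp only [extendFin_coe, fourierRow_apply, EllOne.sum_smul_single] at h
    exact h
  · rw [sub_eq_add_neg, ENNReal.rpow_add _ _ hn0 hnt]
    refine lpQuasinorm_le_of_forall_le_eq_zero hp hpt (fun k hk => ?_) fun k => ?_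
    · simp [extendFin_of_le _ hk]
    · rw [extendFin_coe, extendFin_coe, ← ofReal_norm (WithLp.toLp 1 _), EllOne.norm_single,
        ENNReal.ofReal_one, mul_one, ← ofReal_norm, ENNReal.rpow_neg]
      refine (ENNReal.ofReal_le_ofReal (norm_fourierRow_le k)).trans (le_of_eq ?_)
      have : (0 : ℝ) < n := by exact_mod_cast hn
      rw [ENNReal.ofReal_inv_of_pos (by positivity), Real.sqrt_eq_rpow,
        ← ENNReal.ofReal_rpow_of_pos this, ENNReal.ofReal_natCast]

/-- The row expansion rebalanced by √n: the functionals √n · row have norm at most 1, the n vectors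
n^(-1/2) e_k have weak l_2 norm at most 1, and all n coefficients are 1. -/
theorem nuclearTwoQuasinorm_fourierOperator_le {n : ℕ} (hn : 1 ≤ n) {p : ℝ≥0∞} (hp : 0 < p)
    (hpt : p ≠ ∞) :
    nuclearTwoQuasinorm p (fourierOperator n) ≤ (n : ℝ≥0∞) ^ (p⁻¹).toReal := by
  have hn0 : (0 : ℝ) < n := by exact_mod_cast hn
  have hs0 : 0 < Real.sqrt n := Real.sqrt_pos.2 hn0
  have hsC : ((Real.sqrt n : ℝ) : ℂ) ≠ 0 := by exact_mod_cast hs0.ne'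
  set x' : ℕ → StrongDual ℂ (EllOne n) :=
    extendFin fun k => ((Real.sqrt n : ℝ) : ℂ) • fourierRow n k with hx'
  set y : ℕ → EllOne n := extendFin fun k =>
    ((Real.sqrt n : ℝ) : ℂ)⁻¹ • (WithLp.toLp 1 (Pi.single k (1 : ℂ)) : EllOne n) with hy
  refine (iInf₂_le (extendFin fun _ : Fin n => (1 : ℂ)) x').trans ?_
  refine (iInf_le _ y).trans ?_
  refine (iInf_le _ fun k => ?_).trans <| (iInf_le _ ?_).trans <| (iInf_le _ fun x => ?_).trans ?_
  · rcases lt_or_ge k n with h | h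
    · lift k to Fin n using h
      rw [hx', extendFin_coe, norm_smul, Complex.norm_real, Real.norm_of_nonneg hs0.le]
      calc _ ≤ Real.sqrt n * (Real.sqrt n)⁻¹ := by
            gcongr
            exact norm_fourierRow_le k
        _ = 1 := mul_inv_cancel₀ hs0.ne'
    · simp [hx', extendFin_of_le _ h]
  · refine iSup₂_le fun y' hy' => ?_
    refine (lpQuasinorm_le_of_forall_le_eq_zero (n := n) (c := ‖(Real.sqrt n)⁻¹‖ₑ) (by simp)
      (by simp) (fun k hk => by simp [hy, extendFin_of_le _ hk]) fun k => ?_).trans (le_of_eq ?_)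
    · rw [hy, extendFin_coe, ← ofReal_norm, ← ofReal_norm]
      refine ENNReal.ofReal_le_ofReal ?_
      rw [map_smul, norm_smul, norm_inv, norm_inv, Complex.norm_real]
      have h := y'.le_of_opNorm_le hy' (WithLp.toLp 1 (Pi.single k (1 : ℂ)))
      rw [EllOne.norm_single, mul_one] at h
      exact mul_le_of_le_one_right (by positivity) h
    · rw [← ofReal_norm, norm_inv, Real.norm_of_nonneg hs0.le,
        ENNReal.ofReal_inv_of_pos (by positivity), Real.sqrt_eq_rpow,
        ← ENNReal.ofReal_rpow_of_pos hn0, ENNReal.ofReal_natCast, ENNReal.toReal_inv,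
        ENNReal.toReal_ofNat, ← one_div]
      refine ENNReal.mul_inv_cancel ?_ ?_
      · simpa [ENNReal.rpow_eq_zero_iff] using (by omega : n ≠ 0)
      · exact ENNReal.rpow_ne_top_of_nonneg (by norm_num) (ENNReal.natCast_ne_top n)
  · have h := hasSum_of_forall_le_eq_zero (n := n) (f := fun k =>
      (extendFin (fun _ : Fin n => (1 : ℂ)) k * x' k x) • y k) fun k hk => by
      simp [hy, extendFin_of_le _ hk]
    have h2 : ∀ k : Fin n, (extendFin (fun _ : Fin n => (1 : ℂ)) k * x' k x) • y k
        = fourierOperator n x k • (WithLp.toLp 1 (Pi.single k (1 : ℂ)) : EllOne n) := by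
      intro k
      rw [hx', hy, extendFin_coe, extendFin_coe, extendFin_coe, smul_smul, one_mul]
      congr 1
      change ((Real.sqrt n : ℝ) : ℂ) * fourierOperator n x k * _ = _
      field_simp
    simp only [h2, EllOne.sum_smul_single] at h
    exact h
  · refine (lpQuasinorm_le_of_forall_le_eq_zero (n := n) hp hpt (c := 1)
      (fun k hk => by simp [extendFin_of_le _ hk]) fun k => ?_).trans (by simp)
    rw [extendFin_coe]
    simp

theorem nuclearTwoQuasinorm_fourierOperator {n : ℕ} (hn : 1 ≤ n) {p : ℝ≥0∞} (hp : 0 < p)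
    (hp2 : p ≤ 2) :
    nuclearTwoQuasinorm p (fourierOperator n) = (n : ℝ≥0∞) ^ (p⁻¹).toReal := by
  refine le_antisymm (nuclearTwoQuasinorm_fourierOperator_le hn hp (hp2.trans_lt (by simp)).ne)
    (le_nuclearTwoQuasinorm_of_norm_det_eq_one hn hp hp2 ?_)
  have h := norm_det_fourierOperator_pow hn 1
  rwa [pow_one] at h

/-! ### The theorem -/

theorem ENNReal.prod_const_rpow {ι : Type*} (s : Finset ι) {x : ℝ≥0∞} (h0 : x ≠ 0) (ht : x ≠ ∞)
    (f : ι → ℝ) : ∏ i ∈ s, x ^ f i = x ^ ∑ i ∈ s, f i := by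
  classical
  induction s using Finset.induction_on with
  | empty => simp
  | insert i s hi ih =>
    rw [Finset.prod_insert hi, Finset.sum_insert hi, ih, ENNReal.rpow_add _ _ h0 ht]

/-- The relations defining r are stated additively because subtraction in `ℝ≥0∞` truncates; r = ∞
then contributes 1/r = 0. -/
theorem mainTheorem10 :
    ∃ G : ℝ≥0, 0 < G ∧ ∀ n : ℕ, 1 ≤ n → ∀ m : ℕ, 1 ≤ m →
      -- the rank of `A_n ^ m` is `n`
      Module.finrank ℂ (LinearMap.range ((fourierOperator n ^ m : EllOne n →L[ℂ] EllOne n) :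
        EllOne n →ₗ[ℂ] EllOne n)) = n ∧
      -- lower bound through the quasinorms `ν_{s_k}`; `1/r = ∑ 1/s_k - (m+1)/2`
      (∀ s : Fin m → ℝ≥0∞, (∀ k, 0 < s k ∧ s k ≤ 1) →
        ∀ r t : ℝ≥0∞, r⁻¹ + ((m : ℝ≥0∞) + 1) / 2 = ∑ k, (s k)⁻¹ → 0 < t → t ≤ r →
          (G : ℝ≥0∞) * (n : ℝ≥0∞) ^ ((t⁻¹).toReal - (r⁻¹).toReal) *
              ∏ k, nuclearQuasinorm (s k) (fourierOperator n)
            ≤ schattenFactorization t (fourierOperator n ^ m)) ∧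
      ∀ s : Fin m → ℝ≥0∞, (∀ k, 0 < s k ∧ s k ≤ 2) →
        -- the eigenvalue identity; `1/q = ∑ 1/s_k`
        (∀ q : ℝ≥0∞, q⁻¹ = ∑ k, (s k)⁻¹ →
          ∏ k, nuclearTwoQuasinorm (s k) (fourierOperator n)
            = eigenvalueQuasinorm q (fourierOperator n ^ m)) ∧
        -- sharpness of the factorization estimate; `1/r = ∑ 1/s_k - 1/2`
        (∀ r t : ℝ≥0∞, r⁻¹ + 1 / 2 = ∑ k, (s k)⁻¹ → 0 < t → t ≤ r →
          (G : ℝ≥0∞) * (n : ℝ≥0∞) ^ ((t⁻¹).toReal - (r⁻¹).toReal) *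
              ∏ k, nuclearTwoQuasinorm (s k) (fourierOperator n)
            ≤ schattenFactorization t (fourierOperator n ^ m)) ∧
        -- sharpness of the eigenvalue estimate; `1/q = ∑ 1/s_k`
        (∀ q t : ℝ≥0∞, q⁻¹ = ∑ k, (s k)⁻¹ → 0 < t → t ≤ q →
          (n : ℝ≥0∞) ^ ((t⁻¹).toReal - (q⁻¹).toReal) *
              ∏ k, nuclearTwoQuasinorm (s k) (fourierOperator n)
            = eigenvalueQuasinorm t (fourierOperator n ^ m)) := by
  refine ⟨1, one_pos, fun n hn m hm => ?_⟩
  have hn0 : (n : ℝ≥0∞) ≠ 0 := by exact_mod_cast (by omega : n ≠ 0)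
  have hnt : (n : ℝ≥0∞) ≠ ∞ := ENNReal.natCast_ne_top n
  have hdet := norm_det_fourierOperator_pow hn m
  have hsum : ∀ s : Fin m → ℝ≥0∞, (∀ k, 0 < s k) →
      ∑ k, (s k)⁻¹ ≠ ∞ ∧ (∑ k, (s k)⁻¹).toReal = ∑ k, ((s k)⁻¹).toReal := fun s hs =>
    ⟨ENNReal.sum_ne_top.2 fun k _ => ENNReal.inv_ne_top.2 (hs k).ne',
      ENNReal.toReal_sum fun k _ => ENNReal.inv_ne_top.2 (hs k).ne'⟩
  refine ⟨finrank_range_fourierOperator_pow hn m, fun s hs r t hr ht _ => ?_, fun s hs => ?_⟩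
  · obtain ⟨hfin, htoReal⟩ := hsum s fun k => (hs k).1
    have hr' : (r⁻¹).toReal + ((m : ℝ) + 1) / 2 = ∑ k, ((s k)⁻¹).toReal := by
      rw [← htoReal, ← hr, ENNReal.toReal_add (ne_top_of_le_ne_top hfin (hr ▸ le_self_add))
        (ne_top_of_le_ne_top hfin (hr ▸ le_add_self)), ENNReal.toReal_div,
        ENNReal.toReal_add (by simp) (by simp)]
      simp
    calc _ ≤ (1 : ℝ≥0∞) * (n : ℝ≥0∞) ^ ((t⁻¹).toReal - (r⁻¹).toReal) *
          ∏ k, (n : ℝ≥0∞) ^ (((s k)⁻¹).toReal - 1 / 2) := by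
          refine mul_le_mul' le_rfl (Finset.prod_le_prod' fun k _ => ?_)
          exact nuclearQuasinorm_fourierOperator_le hn (hs k).1
            ((hs k).2.trans_lt ENNReal.one_lt_top).ne
      -- The m halves cancel all but one of the m + 1: ∑ (1/s_k - 1/2) = 1/r + 1/2.
      _ = (n : ℝ≥0∞) ^ ((t⁻¹).toReal + 1 / 2) := by
          rw [ENNReal.prod_const_rpow _ hn0 hnt, one_mul, ← ENNReal.rpow_add _ _ hn0 hnt,
            Finset.sum_sub_distrib, ← hr']
          congr 1
          simp
          ring
      _ ≤ _ := le_schattenFactorization_of_norm_det_eq_one hn ht hdet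
  · obtain ⟨hfin, htoReal⟩ := hsum s fun k => (hs k).1
    have hprod : ∏ k, nuclearTwoQuasinorm (s k) (fourierOperator n)
        = (n : ℝ≥0∞) ^ ∑ k, ((s k)⁻¹).toReal := by
      rw [← ENNReal.prod_const_rpow _ hn0 hnt]
      exact Finset.prod_congr rfl fun k _ =>
        nuclearTwoQuasinorm_fourierOperator hn (hs k).1 (hs k).2
    rw [hprod]
    refine ⟨fun q hq => ?_, fun r t hr ht _ => ?_, fun q t hq ht _ => ?_⟩
    · rw [eigenvalueQuasinorm_fourierOperator_pow hn, ← htoReal, ← hq, ENNReal.toReal_inv, one_div]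
    · have hr' : (r⁻¹).toReal + 1 / 2 = ∑ k, ((s k)⁻¹).toReal := by
        rw [← htoReal, ← hr, ENNReal.toReal_add (ne_top_of_le_ne_top hfin (hr ▸ le_self_add))
          (ne_top_of_le_ne_top hfin (hr ▸ le_add_self))]
        simp
      refine le_trans (le_of_eq ?_) (le_schattenFactorization_of_norm_det_eq_one hn ht hdet)
      rw [ENNReal.coe_one, one_mul, ← ENNReal.rpow_add _ _ hn0 hnt, ← hr']
      congr 1
      ring
    · rw [eigenvalueQuasinorm_fourierOperator_pow hn, ← htoReal, ← hq,
        ← ENNReal.rpow_add _ _ hn0 hnt, sub_add_cancel, ENNReal.toReal_inv, one_div]
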